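/- Let $p\ge 7$ be a prime and let $k$ be an integer with $1\le k\le (p-1)/2$ and $k^2\not\equiv\pm1\pmod p$. Let $\Lambda={\rm GP}(p,k)$ be the generalized Petersen graph, that is, the simple graph with vertex set $\mathbb{Z}_2\times\mathbb{Z}_p$ and edge set $E_1\cup E_2\cup E_3$, where $$E_1=\{(0,j)(0,j+1) : j\in\mathbb{Z}_p\},\quad E_2=\{(1,j)(1,j+k) : j\in\mathbb{Z}_p\},\quad E_3=\{(0,j)(1,j) : j\in\mathbb{Z}_p\}$$ are the sets of outer edges, inner edges and spokes. Let $\Psi=(\Lambda,\sigma)$ be a signed graph on $\Lambda$, where $\sigma:E_1\cup E_2\cup E_3\to\{+1,-1\}$ is an arbitrary sign function, and let ${\rm Aut}(\Psi)$ be the group of those automorphisms of the graph $\Lambda$ that preserve the sign of every edge. For a set $F$ of edges put $\sigma(F)=\{\sigma(e) : e\in F\}$. The group ${\rm Aut}(\Lambda)$ is the dihedral group $\langle\alpha,\beta \mid \alpha^p=\beta^2=1,\ \alpha\beta=\beta\alpha^{-1}\rangle$ of order $2p$, where $\alpha:(i,j)\mapsto(i,j+1)$ and $\beta:(i,j)\mapsto(i,-j)$.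 If $|\sigma(E_1)|=|\sigma(E_2)|=|\sigma(E_3)|=1$, then ${\rm Aut}(\Psi)={\rm Aut}(\Lambda)$; otherwise ${\rm Aut}(\Psi)$ has at most two elements. -/

import Mathlib

/-- A signed graph with underlying simple graph `Γ`: a sign function on the edges of `Γ`,
with values in the two-element group `ℤˣ = {1, -1}`. -/
structure SignedGraph {V : Type*} (Γ : SimpleGraph V) where
  sign : Γ.edgeSet → ℤˣ

namespace SignedGraph

variable {V : Type*} {Γ : SimpleGraph V}

/-- The set `σ(F)` of signs of the edges that belong to `F`. -/
def signs (Ψ : SignedGraph Γ) (F : Set (Sym2 V)) : Set ℤˣ :=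
  {s | ∃ e : Γ.edgeSet, (e : Sym2 V) ∈ F ∧ Ψ.sign e = s}

/-- The automorphism group of a signed graph: the automorphisms of the underlying graph that
preserve the sign of every edge, as a subgroup of `Aut(Γ)` (whose product is composition). -/
def Aut (Ψ : SignedGraph Γ) : Subgroup (Γ ≃g Γ) where
  carrier := {φ | ∀ e : Γ.edgeSet, Ψ.sign (φ.mapEdgeSet e) = Ψ.sign e}
  one_mem' := by
    intro e
    congr 1
    ext1
    exact congrFun Sym2.map_id e.1
  mul_mem' := by
    intro φ ψ hφ hψ e
    rw [← hψ e, ← hφ (ψ.mapEdgeSet e)]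
    congr 1
    ext1
    exact (Sym2.map_map (g := φ) (f := ψ) e.1).symm
  inv_mem' := by
    intro φ hφ e
    have h := hφ (φ.mapEdgeSet.symm e)
    rw [Equiv.apply_symm_apply] at h
    exact h.symm

end SignedGraph

namespace GenPetersen

/-- The outer edges `(0, j)(0, j+1)`. -/
def outerEdges (n : ℕ) : Set (Sym2 (ZMod 2 × ZMod n)) :=
  {e | ∃ j : ZMod n, e = s((0, j), (0, j + 1))}

/-- The inner edges `(1, j)(1, j+k)`. -/
def innerEdges (n k : ℕ) : Set (Sym2 (ZMod 2 × ZMod n)) :=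
  {e | ∃ j : ZMod n, e = s((1, j), (1, j + (k : ZMod n)))}

/-- The spokes `(0, j)(1, j)`. -/
def spokes (n : ℕ) : Set (Sym2 (ZMod 2 × ZMod n)) :=
  {e | ∃ j : ZMod n, e = s((0, j), (1, j))}

/-- The generalized Petersen graph `GP(n, k)` on the vertex set `ℤ/2 × ℤ/n`. -/
def graph (n k : ℕ) : SimpleGraph (ZMod 2 × ZMod n) :=
  SimpleGraph.fromEdgeSet (outerEdges n ∪ innerEdges n k ∪ spokes n)

/-- The rotation `(i, j) ↦ (i, j + 1)`, an automorphism of `GP(n, k)`. -/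
def rotation (n k : ℕ) : graph n k ≃g graph n k where
  toEquiv := (Equiv.refl (ZMod 2)).prodCongr (Equiv.addRight (1 : ZMod n))
  map_rel_iff' := by
    rintro ⟨a, b⟩ ⟨c, d⟩
    simp only [graph, SimpleGraph.fromEdgeSet_adj, outerEdges, innerEdges, spokes,
      Set.mem_union, Set.mem_ofPred_eq, Equiv.prodCongr_apply, Prod.map_apply, Equiv.refl_apply,
      Equiv.coe_addRight, Sym2.eq_iff, Prod.mk.injEq, ne_eq, add_left_inj]
    refine and_congr_left fun _ => or_congr (or_congr ?_ ?_) ?_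
    all_goals
      constructor
      · rintro ⟨j, h⟩
        exact ⟨j - 1, by grind⟩
      · rintro ⟨j, h⟩
        exact ⟨j + 1, by grind⟩

/-- The reflection `(i, j) ↦ (i, -j)`, an automorphism of `GP(n, k)`. -/
def reflection (n k : ℕ) : graph n k ≃g graph n k where
  toEquiv := (Equiv.refl (ZMod 2)).prodCongr (Equiv.neg (ZMod n))
  map_rel_iff' := by
    rintro ⟨a, b⟩ ⟨c, d⟩
    simp only [graph, SimpleGraph.fromEdgeSet_adj, outerEdges, innerEdges, spokes,
      Set.mem_union, Set.mem_ofPred_eq, Equiv.prodCongr_apply, Prod.map_apply, Equiv.refl_apply,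
      Equiv.neg_apply, Sym2.eq_iff, Prod.mk.injEq, ne_eq, neg_inj]
    refine and_congr_left fun _ => or_congr (or_congr ?_ ?_) ?_
    · constructor
      · rintro ⟨j, h⟩
        exact ⟨-j - 1, by grind⟩
      · rintro ⟨j, h⟩
        exact ⟨-j - 1, by grind⟩
    · constructor
      · rintro ⟨j, h⟩
        exact ⟨-j - (k : ZMod n), by grind⟩
      · rintro ⟨j, h⟩
        exact ⟨-j - (k : ZMod n), by grind⟩
    · constructor
      · rintro ⟨j, h⟩
        exact ⟨-j, by grind⟩
      · rintro ⟨j, h⟩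
        exact ⟨-j, by grind⟩

end GenPetersen

/-! The main point is that every automorphism of `GP(p, k)` is a map `(i, j) ↦ (i, ±j + a)`. An
invariant separates the edges: the number of closed non-backtracking walks of length eight through a
dart. Up to rotation a dart has one of six types, and a walk shifts the position by `a + b k`, where
`(a, b)` depends only on the types met. The displacements form explicit lists, independent of `p`
and `k`, and the invariant counts those with `a + b k = 0`.

Every generalized Petersen graph has the octagons that alternate rim edges and spokes; they
contribute 2 to a rim edge and 4 to a spoke. All other contributions need `k` to be one of `±2`,
`±1/2`, `±5`, `±1/5`, and even then the three counts are not all equal (`exists_octagonCount`).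
Hence spokes go to spokes (`spoke_map`), each rim goes to a rim with constant step, and exchanging
the rims would force `k² = ±1` (`exists_affine`).

For the signs, each edge class is both stable under all automorphisms and a single rotation orbit. A
subgroup of the dihedral group with more than two elements contains the rotation, by Lagrange and
Cauchy, and so makes the sign constant on each class. -/

namespace SimpleGraph

/-! ### Non-backtracking walks -/

variable {V : Type*} [Fintype V]

open Classical in
/-- The number of walks with `m + 1` edges that never backtrack, whose first edge is the dart
`(a, b)` and whose last edge is the dart `(u, v)`. -/
noncomputable def nonBacktrackingCount (G : SimpleGraph V) (u v : V) : ℕ → V → V → ℕ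
  | 0, a, b => if a = u ∧ b = v then 1 else 0
  | m + 1, a, b =>
    ∑ c ∈ Finset.univ.filter (fun c => G.Adj b c ∧ c ≠ a), nonBacktrackingCount G u v m b c

theorem nonBacktrackingCount_map (G : SimpleGraph V) (φ : G ≃g G) (u v : V) (m : ℕ) (a b : V) :
    G.nonBacktrackingCount (φ u) (φ v) m (φ a) (φ b) = G.nonBacktrackingCount u v m a b := by
  induction m generalizing a b with
  | zero =>
    classical
    simp only [nonBacktrackingCount]
    exact if_congr (and_congr φ.injective.eq_iff φ.injective.eq_iff) rfl rfl
  | succ m ih =>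
    simp only [nonBacktrackingCount]
    symm
    refine Finset.sum_equiv φ.toEquiv (fun c => ?_) (fun c _ => (ih b c).symm)
    simp [φ.map_adj_iff]

end SimpleGraph

/-! ### Darts of `GP(n, k)` and displacements of walks -/

namespace GenPetersen

theorem zmod_two_cases (i : ZMod 2) : i = 0 ∨ i = 1 := by
  revert i; decide

theorem adj_outer {n k : ℕ} (h1 : (1 : ZMod n) ≠ 0) (a : ZMod n) (x : ZMod 2 × ZMod n) :
    (graph n k).Adj (0, a) x ↔ x = (0, a + 1) ∨ x = (0, a - 1) ∨ x = (1, a) := by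
  obtain ⟨i, b⟩ := x
  have h01 : (0 : ZMod 2) ≠ 1 := by decide
  simp only [graph, SimpleGraph.fromEdgeSet_adj, outerEdges, innerEdges, spokes,
    Set.mem_union, Set.mem_ofPred_eq, Sym2.eq_iff, Prod.mk.injEq, ne_eq]
  constructor
  · rintro ⟨(⟨j, h⟩ | ⟨j, h⟩) | ⟨j, h⟩, hne⟩ <;> grind
  · rintro (⟨rfl, rfl⟩ | ⟨rfl, rfl⟩ | ⟨rfl, rfl⟩)
    · exact ⟨Or.inl (Or.inl ⟨a, by simp⟩), by simpa using h1⟩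
    · exact ⟨Or.inl (Or.inl ⟨a - 1, by simp⟩), fun h => h1 (by linear_combination h.2)⟩
    · exact ⟨Or.inr ⟨_, Or.inl ⟨⟨trivial, rfl⟩, rfl, rfl⟩⟩, by simp⟩

theorem adj_inner {n k : ℕ} (hk : (k : ZMod n) ≠ 0) (a : ZMod n) (x : ZMod 2 × ZMod n) :
    (graph n k).Adj (1, a) x ↔ x = (1, a + k) ∨ x = (1, a - k) ∨ x = (0, a) := by
  obtain ⟨i, b⟩ := x
  have h01 : (0 : ZMod 2) ≠ 1 := by decide
  simp only [graph, SimpleGraph.fromEdgeSet_adj, outerEdges, innerEdges, spokes,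
    Set.mem_union, Set.mem_ofPred_eq, Sym2.eq_iff, Prod.mk.injEq, ne_eq]
  constructor
  · rintro ⟨(⟨j, h⟩ | ⟨j, h⟩) | ⟨j, h⟩, hne⟩ <;> grind
  · rintro (⟨rfl, rfl⟩ | ⟨rfl, rfl⟩ | ⟨rfl, rfl⟩)
    · exact ⟨Or.inl (Or.inr ⟨a, by simp⟩), by simpa using hk⟩
    · exact ⟨Or.inl (Or.inr ⟨a - k, by simp⟩), by grind⟩
    · exact ⟨Or.inr ⟨_, Or.inr ⟨⟨trivial, rfl⟩, rfl, rfl⟩⟩, by simp⟩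

/-- The orbits of the rotation on the darts of a generalized Petersen graph: outer and inner darts
in the positive and negative direction, and spokes directed to the inner or outer rim. -/
inductive DartType
  | outerPos | outerNeg | inward | outward | innerPos | innerNeg
  deriving DecidableEq

namespace DartType

/-- The tail of the dart of type `t` whose head lies at position `j`. -/
def tail {n : ℕ} (K : ZMod n) (j : ZMod n) : DartType → ZMod 2 × ZMod n
  | outerPos => (0, j - 1)
  | outerNeg => (0, j + 1)
  | inward => (0, j)
  | outward => (1, j)
  | innerPos => (1, j - K)
  | innerNeg => (1, j + K)

/-- The head of the dart of type `t` whose head lies at position `j`. -/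
def head {n : ℕ} (j : ZMod n) : DartType → ZMod 2 × ZMod n
  | outerPos => (0, j)
  | outerNeg => (0, j)
  | inward => (1, j)
  | outward => (0, j)
  | innerPos => (1, j)
  | innerNeg => (1, j)

/-- The two continuations of a dart without backtracking: the type of the next dart, and its
displacement `(a, b)`, standing for `a + b k`. -/
def next : DartType → (DartType × ℤ × ℤ) × (DartType × ℤ × ℤ)
  | outerPos => ((outerPos, 1, 0), (inward, 0, 0))
  | outerNeg => ((outerNeg, -1, 0), (inward, 0, 0))
  | inward => ((innerPos, 0, 1), (innerNeg, 0, -1))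
  | outward => ((outerPos, 1, 0), (outerNeg, -1, 0))
  | innerPos => ((innerPos, 0, 1), (outward, 0, 0))
  | innerNeg => ((innerNeg, 0, -1), (outward, 0, 0))

/-- The displacements of the non-backtracking walks with `m` steps from a dart of type `t` to a
dart of type `t₀`. -/
def displacements (t₀ : DartType) : ℕ → DartType → List (ℤ × ℤ)
  | 0, t => if t = t₀ then [(0, 0)] else []
  | m + 1, t =>
    ((displacements t₀ m (next t).1.1).map (· + (next t).1.2)) ++
      ((displacements t₀ m (next t).2.1).map (· + (next t).2.2))

end DartType

open DartType

/-- The two directions on a rim are told apart by `2 ≠ 0` on the outer rim and `2k ≠ 0` on the inner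
one. -/
theorem tail_head_inj {n k : ℕ} (h2 : (2 : ZMod n) ≠ 0) (hk2 : (2 * k : ZMod n) ≠ 0)
    {t t' : DartType} {i j : ZMod n}
    (ht : t.tail (k : ZMod n) i = t'.tail (k : ZMod n) j) (hh : t.head i = t'.head j) :
    t = t' ∧ i = j := by
  have h01 : (0 : ZMod 2) ≠ 1 := by decide
  have hj : j + 1 ≠ j - 1 := fun h => h2 (by linear_combination h)
  cases t <;> cases t' <;> simp only [tail, head, Prod.mk.injEq] at ht hh <;> grind

/-- The graph is cubic, so exactly two darts continue a given one without backtracking, and `next`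
lists them. -/
theorem nonBacktrackingCount_succ {n k : ℕ} [NeZero n] (h2 : (2 : ZMod n) ≠ 0)
    (hk2 : (2 * k : ZMod n) ≠ 0) (u v : ZMod 2 × ZMod n) (m : ℕ) (t : DartType) (j : ZMod n) :
    (graph n k).nonBacktrackingCount u v (m + 1) (t.tail (k : ZMod n) j) (t.head j) =
      (graph n k).nonBacktrackingCount u v m
        (t.next.1.1.tail (k : ZMod n) (j + (t.next.1.2.1 + t.next.1.2.2 * k : ZMod n)))
        (t.next.1.1.head (j + (t.next.1.2.1 + t.next.1.2.2 * k : ZMod n))) +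
      (graph n k).nonBacktrackingCount u v m
        (t.next.2.1.tail (k : ZMod n) (j + (t.next.2.2.1 + t.next.2.2.2 * k : ZMod n)))
        (t.next.2.1.head (j + (t.next.2.2.1 + t.next.2.2.2 * k : ZMod n))) := by
  classical
  have h01 : (0 : ZMod 2) ≠ 1 := by decide
  have h1 : (1 : ZMod n) ≠ 0 := fun h => h2 (by linear_combination 2 * h)
  have hk : (k : ZMod n) ≠ 0 := fun h => hk2 (by rw [h, mul_zero])
  have hj : j + 1 ≠ j - 1 := fun h => h2 (by linear_combination h)
  have ht₁ : t.next.1.1.tail (k : ZMod n) (j + (t.next.1.2.1 + t.next.1.2.2 * k : ZMod n)) =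
      t.head j := by
    cases t <;> simp [tail, head, next]
  have ht₂ : t.next.2.1.tail (k : ZMod n) (j + (t.next.2.2.1 + t.next.2.2.2 * k : ZMod n)) =
      t.head j := by
    cases t <;> simp [tail, head, next]
  have hne : t.next.1.1.head (j + (t.next.1.2.1 + t.next.1.2.2 * k : ZMod n)) ≠
      t.next.2.1.head (j + (t.next.2.2.1 + t.next.2.2.2 * k : ZMod n)) := by
    cases t <;> simp only [head, next, ne_eq, Prod.mk.injEq, Int.cast_zero, Int.cast_one,
      Int.cast_neg, zero_mul, add_zero, ← sub_eq_add_neg] <;> grind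
  rw [ht₁, ht₂, ← Finset.sum_pair hne]
  refine Finset.sum_congr ?_ fun _ _ => rfl
  ext ⟨i, c⟩
  simp only [Finset.mem_filter, Finset.mem_univ, true_and, Finset.mem_insert,
    Finset.mem_singleton]
  cases t <;> simp only [tail, head, next, adj_outer h1, adj_inner hk, ne_eq, Prod.mk.injEq,
    Int.cast_zero, Int.cast_one, Int.cast_neg, zero_mul, add_zero, ← sub_eq_add_neg] <;> grind

/-- This separates combinatorics from arithmetic: the displacements live in `ℤ × ℤ` and can be
computed once for all `n` and `k`, which enter only through the test on `d.1 + d.2 * k`. -/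
theorem nonBacktrackingCount_eq_sum {n k : ℕ} [NeZero n] (h2 : (2 : ZMod n) ≠ 0)
    (hk2 : (2 * k : ZMod n) ≠ 0) (t₀ : DartType) (j₀ : ZMod n) (m : ℕ) (t : DartType)
    (j : ZMod n) :
    (graph n k).nonBacktrackingCount (t₀.tail (k : ZMod n) j₀) (t₀.head j₀) m
        (t.tail (k : ZMod n) j) (t.head j) =
      ((t₀.displacements m t).map fun d : ℤ × ℤ =>
        if j + (d.1 + d.2 * k : ZMod n) = j₀ then 1 else 0).sum := by
  induction m generalizing t j with
  | zero =>
    simp only [SimpleGraph.nonBacktrackingCount, displacements]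
    by_cases h : t = t₀
    · subst h
      by_cases hj : j = j₀
      · simp [hj]
      · rw [if_neg fun h => hj (tail_head_inj h2 hk2 h.1 h.2).2]
        simp [hj]
    · rw [if_neg fun h' => h (tail_head_inj h2 hk2 h'.1 h'.2).1]
      simp [h]
  | succ m ih =>
    rw [nonBacktrackingCount_succ h2 hk2, ih, ih]
    simp only [displacements, List.map_append, List.sum_append, List.map_map]
    congr 3 <;>
    · funext d
      simp only [Function.comp, Prod.fst_add, Prod.snd_add]
      push_cast
      ring_nf

end GenPetersen

/-! ### Counting closed walks of length eight -/

namespace GenPetersen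

open DartType

/-- The indicator of `a + b K = 0`. -/
def closes {n : ℕ} (K : ZMod n) (d : ℤ × ℤ) : ℕ :=
  if (d.1 + d.2 * K : ZMod n) = 0 then 1 else 0

section Closes

variable {n : ℕ} {K : ZMod n}

theorem closes_eq_zero {a b : ℤ} (h : (a + b * K : ZMod n) ≠ 0) : closes K (a, b) = 0 :=
  if_neg h

theorem closes_smul [Fact n.Prime] (c a b : ℤ) (hc : (c : ZMod n) ≠ 0) :
    closes K (c * a, c * b) = closes K (a, b) := by
  refine if_congr ?_ rfl rfl
  push_cast
  rw [mul_assoc, ← mul_add, mul_eq_zero, or_iff_right hc]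

theorem closes_add_le_one {d e : ℤ × ℤ}
    (h : (d.1 + d.2 * K : ZMod n) = 0 → (e.1 + e.2 * K : ZMod n) = 0 → False) :
    closes K d + closes K e ≤ 1 := by
  unfold closes
  split <;> split <;> first | omega | (exact (h ‹_› ‹_›).elim)

end Closes

open List in
/-- The displacements of the non-backtracking walks with eight steps between outer darts in
direction `s`. -/
def rimDisplacements (s : ℤ) : List (ℤ × ℤ) :=
  replicate 5 (5 * s, 1) ++ replicate 5 (5 * s, -1) ++ replicate 4 (4 * s, 2) ++
    replicate 4 (4 * s, -2) ++ replicate 3 (3 * s, 3) ++ replicate 3 (3 * s, -3) ++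
    replicate 2 (2 * s, 4) ++ replicate 2 (2 * s, -4) ++ [(s, 5), (s, -5), (2 * s, 2),
      (2 * s, -2), (0, 0), (0, 0), (2 * s, 0), (2 * s, 0), (0, 2), (0, -2), (8 * s, 0)]

open List in
/-- The displacements of the non-backtracking walks with eight steps between spokes. -/
def spokeDisplacements : List (ℤ × ℤ) :=
  replicate 4 (0, 0) ++ replicate 2 (0, 2) ++ replicate 2 (2, 0) ++ replicate 2 (-2, 0) ++
    replicate 2 (0, -2) ++ [(1, 5), (-1, -5), (1, -5), (-1, 5), (2, 4), (-2, -4), (2, -4), (-2, 4),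
      (3, 3), (-3, -3), (3, -3), (-3, 3), (4, 2), (-4, -2), (4, -2), (-4, 2),
      (5, 1), (-5, -1), (5, -1), (-5, 1), (2, 2), (-2, -2), (2, -2), (-2, 2)]

theorem displacements_outerPos :
    (displacements outerPos 8 outerPos).Perm (rimDisplacements 1) := by decide

theorem displacements_outerNeg :
    (displacements outerNeg 8 outerNeg).Perm (rimDisplacements (-1)) := by decide

theorem displacements_innerPos :
    (displacements innerPos 8 innerPos).Perm ((rimDisplacements 1).map Prod.swap) := by decide

theorem displacements_innerNeg :
    (displacements innerNeg 8 innerNeg).Perm ((rimDisplacements (-1)).map Prod.swap) := by decide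

theorem displacements_inward :
    (displacements inward 8 inward).Perm spokeDisplacements := by decide

theorem displacements_outward :
    (displacements outward 8 outward).Perm spokeDisplacements := by decide

/-- The number of closed non-backtracking walks of length eight through the dart `(u, v)`. -/
noncomputable def octagonCount (n k : ℕ) [NeZero n] (u v : ZMod 2 × ZMod n) : ℕ :=
  -- Eight steps between darts make nine edges, the ninth repeating the first; thus the closing turn
  -- does not backtrack either.
  (graph n k).nonBacktrackingCount u v 8 u v

theorem octagonCount_map {n k : ℕ} [NeZero n] (φ : graph n k ≃g graph n k)
    (u v : ZMod 2 × ZMod n) : octagonCount n k (φ u) (φ v) = octagonCount n k u v :=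
  SimpleGraph.nonBacktrackingCount_map _ φ u v 8 u v

theorem octagonCount_eq_sum {n k : ℕ} [NeZero n] (h2 : (2 : ZMod n) ≠ 0)
    (hk2 : (2 * k : ZMod n) ≠ 0) {t : DartType} {l : List (ℤ × ℤ)}
    (h : (t.displacements 8 t).Perm l) (j : ZMod n) :
    octagonCount n k (t.tail (k : ZMod n) j) (t.head j) = (l.map (closes (k : ZMod n))).sum := by
  rw [octagonCount, nonBacktrackingCount_eq_sum h2 hk2, ← (h.map _).sum_eq]
  simp only [add_eq_left]
  rfl

/-- Scaling by units reduces each displacement to a primitive pair. Of these, `(1, 0)`, `(0, 1)` and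
`(1, ±1)` never close, the last because `K ^ 2 ≠ 1`. The inner rim has the outer formula with
coordinates swapped. -/
theorem sum_closes_displacements {p : ℕ} [Fact p.Prime] {K : ZMod p} (h2 : (2 : ZMod p) ≠ 0)
    (h3 : (3 : ZMod p) ≠ 0) (hk0 : K ≠ 0) (hk : K ^ 2 ≠ 1) :
    ((rimDisplacements 1).map (closes K)).sum =
      2 + closes K (1, 5) + closes K (1, -5) + 2 * (closes K (1, 2) + closes K (1, -2)) +
        4 * (closes K (2, 1) + closes K (2, -1)) + 5 * (closes K (5, 1) + closes K (5, -1)) ∧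
    ((rimDisplacements (-1)).map (closes K)).sum =
      2 + closes K (1, 5) + closes K (1, -5) + 2 * (closes K (1, 2) + closes K (1, -2)) +
        4 * (closes K (2, 1) + closes K (2, -1)) + 5 * (closes K (5, 1) + closes K (5, -1)) ∧
    (((rimDisplacements 1).map Prod.swap).map (closes K)).sum =
      2 + closes K (5, 1) + closes K (5, -1) + 2 * (closes K (2, 1) + closes K (2, -1)) +
        4 * (closes K (1, 2) + closes K (1, -2)) + 5 * (closes K (1, 5) + closes K (1, -5)) ∧
    (((rimDisplacements (-1)).map Prod.swap).map (closes K)).sum =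
      2 + closes K (5, 1) + closes K (5, -1) + 2 * (closes K (2, 1) + closes K (2, -1)) +
        4 * (closes K (1, 2) + closes K (1, -2)) + 5 * (closes K (1, 5) + closes K (1, -5)) ∧
    (spokeDisplacements.map (closes K)).sum =
      4 + 2 * (closes K (5, 1) + closes K (5, -1) + closes K (2, 1) + closes K (2, -1) +
        closes K (1, 2) + closes K (1, -2) + closes K (1, 5) + closes K (1, -5)) := by
  have h1' : ((-1 : ℤ) : ZMod p) ≠ 0 := by simp
  have h2' : ((2 : ℤ) : ZMod p) ≠ 0 := by simpa using h2
  have h2m : ((-2 : ℤ) : ZMod p) ≠ 0 := by simpa using h2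
  have h3' : ((3 : ℤ) : ZMod p) ≠ 0 := by simpa using h3
  have h3m : ((-3 : ℤ) : ZMod p) ≠ 0 := by simpa using h3
  have h8' : ((8 : ℤ) : ZMod p) ≠ 0 := by
    have : (8 : ZMod p) = 2 ^ 3 := by norm_num
    simpa [this] using h2
  have h8m : ((-8 : ℤ) : ZMod p) ≠ 0 := by simpa using h8'
  have c00 : closes K (0, 0) = 1 := by simp [closes]
  have c10 : closes K (1, 0) = 0 := closes_eq_zero (by simp)
  have c01 : closes K (0, 1) = 0 := closes_eq_zero (by simpa using hk0)
  have c11 : closes K (1, 1) = 0 := closes_eq_zero fun h => hk (by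
    push_cast at h; linear_combination (K - 1) * h)
  have c11m : closes K (1, -1) = 0 := closes_eq_zero fun h => hk (by
    push_cast at h; linear_combination (- K - 1) * h)
  have c20 : closes K (2, 0) = 0 := (closes_smul 2 1 0 h2').trans c10
  have c20m : closes K (-2, 0) = 0 := (closes_smul (-2) 1 0 h2m).trans c10
  have c80 : closes K (8, 0) = 0 := (closes_smul 8 1 0 h8').trans c10
  have c80m : closes K (-8, 0) = 0 := (closes_smul (-8) 1 0 h8m).trans c10
  have c02 : closes K (0, 2) = 0 := (closes_smul 2 0 1 h2').trans c01
  have c02m : closes K (0, -2) = 0 := (closes_smul (-2) 0 1 h2m).trans c01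
  have c08 : closes K (0, 8) = 0 := (closes_smul 8 0 1 h8').trans c01
  have c08m : closes K (0, -8) = 0 := (closes_smul (-8) 0 1 h8m).trans c01
  have c22 : closes K (2, 2) = 0 := (closes_smul 2 1 1 h2').trans c11
  have c22m : closes K (2, -2) = 0 := (closes_smul 2 1 (-1) h2').trans c11m
  have cm22 : closes K (-2, 2) = 0 := (closes_smul (-2) 1 (-1) h2m).trans c11m
  have cm22m : closes K (-2, -2) = 0 := (closes_smul (-2) 1 1 h2m).trans c11
  have c33 : closes K (3, 3) = 0 := (closes_smul 3 1 1 h3').trans c11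
  have c33m : closes K (3, -3) = 0 := (closes_smul 3 1 (-1) h3').trans c11m
  have cm33 : closes K (-3, 3) = 0 := (closes_smul (-3) 1 (-1) h3m).trans c11m
  have cm33m : closes K (-3, -3) = 0 := (closes_smul (-3) 1 1 h3m).trans c11
  have c24 : closes K (2, 4) = closes K (1, 2) := closes_smul 2 1 2 h2'
  have c24m : closes K (2, -4) = closes K (1, -2) := closes_smul 2 1 (-2) h2'
  have cm24 : closes K (-2, 4) = closes K (1, -2) := closes_smul (-2) 1 (-2) h2m
  have cm24m : closes K (-2, -4) = closes K (1, 2) := closes_smul (-2) 1 2 h2m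
  have c42 : closes K (4, 2) = closes K (2, 1) := closes_smul 2 2 1 h2'
  have c42m : closes K (4, -2) = closes K (2, -1) := closes_smul 2 2 (-1) h2'
  have cm42 : closes K (-4, 2) = closes K (2, -1) := closes_smul (-2) 2 (-1) h2m
  have cm42m : closes K (-4, -2) = closes K (2, 1) := closes_smul (-2) 2 1 h2m
  have cm15 : closes K (-1, 5) = closes K (1, -5) := closes_smul (-1) 1 (-5) h1'
  have cm15m : closes K (-1, -5) = closes K (1, 5) := closes_smul (-1) 1 5 h1'
  have cm51 : closes K (-5, 1) = closes K (5, -1) := closes_smul (-1) 5 (-1) h1'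
  have cm51m : closes K (-5, -1) = closes K (5, 1) := closes_smul (-1) 5 1 h1'
  refine ⟨?_, ?_, ?_, ?_, ?_⟩ <;>
  · simp only [rimDisplacements, spokeDisplacements, List.map_append, List.map_replicate,
      List.sum_append, List.sum_replicate, List.map_cons, List.map_nil, List.sum_cons,
      List.sum_nil, Prod.swap_prod_mk, smul_eq_mul, mul_one, mul_neg, *]
    ring

/-- The octagon counts of the outer edges, inner edges and spokes of `GP(p, k)` do not
coincide. -/
theorem exists_octagonCount {p k : ℕ} [Fact p.Prime] (h2 : (2 : ZMod p) ≠ 0)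
    (h3 : (3 : ZMod p) ≠ 0) (h5 : (5 : ZMod p) ≠ 0) (hk0 : (k : ZMod p) ≠ 0)
    (hk : (k : ZMod p) ^ 2 ≠ 1) (hk' : (k : ZMod p) ^ 2 ≠ -1) :
    ∃ R T S : ℕ, ¬ (R = T ∧ T = S) ∧ ∀ j : ZMod p,
      octagonCount p k (0, j) (0, j + 1) = R ∧ octagonCount p k (0, j) (0, j - 1) = R ∧
      octagonCount p k (1, j) (1, j + k) = T ∧ octagonCount p k (1, j) (1, j - k) = T ∧
      octagonCount p k (0, j) (1, j) = S ∧ octagonCount p k (1, j) (0, j) = S := by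
  have hk2 : (2 * k : ZMod p) ≠ 0 := mul_ne_zero h2 hk0
  obtain ⟨hO, hO', hI, hI', hS⟩ := sum_closes_displacements h2 h3 hk0 hk
  set K := (k : ZMod p)
  refine ⟨((rimDisplacements 1).map (closes K)).sum,
    (((rimDisplacements 1).map Prod.swap).map (closes K)).sum,
    (spokeDisplacements.map (closes K)).sum, ?_, fun j => ⟨?_, ?_, ?_, ?_, ?_, ?_⟩⟩
  rotate_left
  · have h := octagonCount_eq_sum h2 hk2 displacements_outerPos (j + 1)
    rwa [tail, head, add_sub_cancel_right] at h
  · have h := octagonCount_eq_sum h2 hk2 displacements_outerNeg (j - 1)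
    rwa [tail, head, sub_add_cancel, hO', ← hO] at h
  · have h := octagonCount_eq_sum h2 hk2 displacements_innerPos (j + K)
    rwa [tail, head, add_sub_cancel_right] at h
  · have h := octagonCount_eq_sum h2 hk2 displacements_innerNeg (j - K)
    rwa [tail, head, sub_add_cancel, hI', ← hI] at h
  · exact octagonCount_eq_sum h2 hk2 displacements_inward j
  · exact octagonCount_eq_sum h2 hk2 displacements_outward j
  rw [hO, hI, hS]
  clear hO hO' hI hI' hS
  -- In each family at most one sign closes. Moreover `±2` meets `±1/2` only if `3 = 0` or `5 = 0`,
  -- and `±5` meets `±1/5` only if `K ^ 2 = ±1`.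
  have b1 : closes K (1, 5) + closes K (1, -5) ≤ 1 := closes_add_le_one fun h h' => h2 (by
    push_cast at h h'; linear_combination h + h')
  have b2 : closes K (1, 2) + closes K (1, -2) ≤ 1 := closes_add_le_one fun h h' => h2 (by
    push_cast at h h'; linear_combination h + h')
  have b3 : closes K (2, 1) + closes K (2, -1) ≤ 1 := closes_add_le_one fun h h' => hk2 (by
    push_cast at h h'; linear_combination h - h')
  have b4 : closes K (5, 1) + closes K (5, -1) ≤ 1 := closes_add_le_one fun h h' => hk2 (by
    push_cast at h h'; linear_combination h - h')
  have d1 : closes K (1, 2) + closes K (2, 1) ≤ 1 := closes_add_le_one fun h h' => h3 (by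
    push_cast at h h'; linear_combination 2 * h' - h)
  have d2 : closes K (1, 2) + closes K (2, -1) ≤ 1 := closes_add_le_one fun h h' => h5 (by
    push_cast at h h'; linear_combination 2 * h' + h)
  have d3 : closes K (1, -2) + closes K (2, 1) ≤ 1 := closes_add_le_one fun h h' => h5 (by
    push_cast at h h'; linear_combination 2 * h' + h)
  have d4 : closes K (1, -2) + closes K (2, -1) ≤ 1 := closes_add_le_one fun h h' => h3 (by
    push_cast at h h'; linear_combination 2 * h' - h)
  have e1 : closes K (1, 5) + closes K (5, 1) ≤ 1 := closes_add_le_one fun h h' => hk (by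
    push_cast at h h'; linear_combination K * h' - h)
  have e2 : closes K (1, 5) + closes K (5, -1) ≤ 1 := closes_add_le_one fun h h' => hk' (by
    push_cast at h h'; linear_combination -K * h' + h)
  have e3 : closes K (1, -5) + closes K (5, 1) ≤ 1 := closes_add_le_one fun h h' => hk' (by
    push_cast at h h'; linear_combination K * h' + h)
  have e4 : closes K (1, -5) + closes K (5, -1) ≤ 1 := closes_add_le_one fun h h' => hk (by
    push_cast at h h'; linear_combination -K * h' - h)
  have hd : (closes K (1, 2) + closes K (1, -2)) + (closes K (2, 1) + closes K (2, -1)) ≤ 1 := by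
    clear b1 b4 e1 e2 e3 e4
    omega
  have he : (closes K (1, 5) + closes K (1, -5)) + (closes K (5, 1) + closes K (5, -1)) ≤ 1 := by
    clear b2 b3 d1 d2 d3 d4 hd
    omega
  clear b1 b2 b3 b4 d1 d2 d3 d4 e1 e2 e3 e4
  -- Let `A, B, C, D` be the indicators of `±1/5, ±1/2, ±2, ±5`. Equal rim counts mean `C - B = 2 *
  -- (A - D)`; with `B + C ≤ 1` and `A + D ≤ 1` all four vanish, leaving 2 for the rims and 4 for
  -- the spokes.
  omega

/-- An automorphism of `GP(p, k)` maps spokes to spokes. -/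
theorem spoke_map {p k : ℕ} [Fact p.Prime] (h2 : (2 : ZMod p) ≠ 0)
    (h3 : (3 : ZMod p) ≠ 0) (h5 : (5 : ZMod p) ≠ 0) (hk0 : (k : ZMod p) ≠ 0)
    (hk : (k : ZMod p) ^ 2 ≠ 1) (hk' : (k : ZMod p) ^ 2 ≠ -1)
    (φ : graph p k ≃g graph p k) (j : ZMod p) : (φ (0, j)).1 ≠ (φ (1, j)).1 := by
  obtain ⟨R, T, S, hne, hc⟩ := exists_octagonCount h2 h3 h5 hk0 hk hk'
  have h01 : (0 : ZMod 2) ≠ 1 := by decide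
  have hout : ∀ a x, (graph p k).Adj (0, a) x ↔ _ := adj_outer one_ne_zero
  have hinn : ∀ a x, (graph p k).Adj (1, a) x ↔ _ := adj_inner hk0
  have hk2 : (2 * k : ZMod p) ≠ 0 := mul_ne_zero h2 hk0
  by_cases hRT : R = T
  -- Here `S` differs from the common rim count, so the count alone recognizes spokes.
  · have hadj : (graph p k).Adj (φ (0, j)) (φ (1, j)) :=
      φ.map_adj_iff.2 ((hout _ _).2 (by simp))
    have hcount := octagonCount_map φ (0, j) (1, j)
    rw [(hc j).2.2.2.2.1] at hcount
    generalize φ (0, j) = x at *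
    obtain ⟨i, a⟩ := x
    obtain rfl | rfl := zmod_two_cases i
    · rw [hout] at hadj
      have := hc a
      grind
    · rw [hinn] at hadj
      have := hc a
      grind
  · have hlayer : ∀ j, (φ (0, j)).1 = 0 ∧ (φ (1, j)).1 = 1 := by
      intro j
      constructor
      · by_contra hi
        obtain ⟨a, ha⟩ : ∃ a, φ (0, j) = (1, a) :=
          ⟨_, Prod.ext ((zmod_two_cases _).resolve_left hi) rfl⟩
        -- At an inner vertex two of the three darts have count `T ≠ R`, so only the spoke could
        -- receive the two outer darts of count `R`.
        have key : ∀ x, (graph p k).Adj (0, j) x → octagonCount p k (0, j) x = R →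
            φ x = (0, a) := by
          intro x hx hR
          rw [← φ.map_adj_iff, ha, hinn] at hx
          rw [← octagonCount_map φ, ha] at hR
          have := hc a
          grind
        have h := (key _ ((hout _ _).2 (by simp)) (hc j).1).trans
          (key _ ((hout _ _).2 (by simp)) (hc j).2.1).symm
        have h := (Prod.ext_iff.1 (φ.injective h)).2
        exact h2 (by linear_combination h)
      · by_contra hi
        obtain ⟨a, ha⟩ : ∃ a, φ (1, j) = (0, a) :=
          ⟨_, Prod.ext ((zmod_two_cases _).resolve_right hi) rfl⟩
        have key : ∀ x, (graph p k).Adj (1, j) x → octagonCount p k (1, j) x = T →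
            φ x = (1, a) := by
          intro x hx hR
          rw [← φ.map_adj_iff, ha, hout] at hx
          rw [← octagonCount_map φ, ha] at hR
          have := hc a
          grind
        have h := (key _ ((hinn _ _).2 (by simp)) (hc j).2.2.1).trans
          (key _ ((hinn _ _).2 (by simp)) (hc j).2.2.2.1).symm
        have h := (Prod.ext_iff.1 (φ.injective h)).2
        exact hk2 (by linear_combination h)
    rw [(hlayer j).1, (hlayer j).2]
    exact h01

end GenPetersen

/-! ### Automorphisms are affine -/

namespace GenPetersen

theorem adj_of_fst_ne {n k : ℕ} (h1 : (1 : ZMod n) ≠ 0) (hk : (k : ZMod n) ≠ 0)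
    {x y : ZMod 2 × ZMod n} (h : (graph n k).Adj x y) (hxy : x.1 ≠ y.1) : y.2 = x.2 := by
  obtain ⟨i, a⟩ := x
  obtain rfl | rfl := zmod_two_cases i
  · rw [adj_outer h1] at h
    grind
  · rw [adj_inner hk] at h
    grind

theorem adj_of_fst_eq {n k : ℕ} (h1 : (1 : ZMod n) ≠ 0) (hk : (k : ZMod n) ≠ 0)
    {x y : ZMod 2 × ZMod n} (h : (graph n k).Adj x y) (hxy : x.1 = y.1) :
    (x.1 = 0 ∧ (y.2 - x.2 = 1 ∨ y.2 - x.2 = -1)) ∨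
      (x.1 = 1 ∧ (y.2 - x.2 = k ∨ y.2 - x.2 = -k)) := by
  have h01 : (0 : ZMod 2) ≠ 1 := by decide
  obtain ⟨i, a⟩ := x
  obtain rfl | rfl := zmod_two_cases i
  · rw [adj_outer h1] at h
    obtain rfl | rfl | rfl := h
    · simp
    · simp
    · exact (h01 hxy).elim
  · rw [adj_inner hk] at h
    obtain rfl | rfl | rfl := h
    · simp
    · simp
    · exact (h01 hxy.symm).elim

/-- Every automorphism of `GP(p, k)` has the form `(i, j) ↦ (i, ± j + a)`. -/
theorem exists_affine {p k : ℕ} [Fact p.Prime] (h2 : (2 : ZMod p) ≠ 0)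
    (h3 : (3 : ZMod p) ≠ 0) (h5 : (5 : ZMod p) ≠ 0) (hk0 : (k : ZMod p) ≠ 0)
    (hk : (k : ZMod p) ^ 2 ≠ 1) (hk' : (k : ZMod p) ^ 2 ≠ -1)
    (φ : graph p k ≃g graph p k) :
    ∃ s a : ZMod p, (s = 1 ∨ s = -1) ∧ ∀ i j, φ (i, j) = (i, s * j + a) := by
  have h01 : (0 : ZMod 2) ≠ 1 := by decide
  have h1 : (1 : ZMod p) ≠ 0 := one_ne_zero
  have hspoke := spoke_map h2 h3 h5 hk0 hk hk' φ
  have hpos : ∀ j, (φ (1, j)).2 = (φ (0, j)).2 := fun j =>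
    adj_of_fst_ne h1 hk0 (φ.map_adj_iff.2 ((adj_outer h1 _ _).2 (by simp))) (hspoke j)
  have hadj : ∀ j, (graph p k).Adj (φ (0, j)) (φ (0, j + 1)) := fun j =>
    φ.map_adj_iff.2 ((adj_outer h1 _ _).2 (by simp))
  have hlayer : ∀ j, (φ (0, j)).1 = (φ (0, j + 1)).1 := by
    intro j
    -- Otherwise the edge to `(0, j + 1)` and the spoke at `(0, j)` would both map to the one spoke
    -- at the image vertex.
    by_contra hne
    have h := adj_of_fst_ne h1 hk0 (hadj j) hne
    have hfst : (φ (1, j)).1 = (φ (0, j + 1)).1 := by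
      have := hspoke j
      generalize (φ (0, j)).1 = x at *
      generalize (φ (0, j + 1)).1 = y at *
      generalize (φ (1, j)).1 = z at *
      revert x y z
      decide
    have := φ.injective (Prod.ext hfst ((hpos j).trans h.symm))
    exact h01 (Prod.ext_iff.1 this).1.symm
  -- Within a rim a step has only two values, opposite to each other; a change of sign would return
  -- to the image of `(0, j)`.
  have hstep : ∀ j, (φ (0, j + 1 + 1)).2 - (φ (0, j + 1)).2 =
      (φ (0, j + 1)).2 - (φ (0, j)).2 := by
    intro j
    have hback : (φ (0, j + 1 + 1)).2 ≠ (φ (0, j)).2 := by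
      intro h
      have := φ.injective (Prod.ext ((hlayer j).trans (hlayer (j + 1))).symm h)
      have := (Prod.ext_iff.1 this).2
      exact h2 (by linear_combination this)
    have e1 := adj_of_fst_eq h1 hk0 (hadj j) (hlayer j)
    have e2 := adj_of_fst_eq h1 hk0 (hadj (j + 1)) (hlayer (j + 1))
    rw [← hlayer j] at e2
    grind
  obtain ⟨s, hs⟩ : ∃ s, s = (φ (0, 0 + 1)).2 - (φ (0, 0)).2 := ⟨_, rfl⟩
  have hnat : ∀ m : ℕ, (φ (0, (m : ZMod p))).1 = (φ (0, 0)).1 ∧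
      (φ (0, (m : ZMod p))).2 = s * m + (φ (0, 0)).2 ∧
      (φ (0, (m : ZMod p) + 1)).2 - (φ (0, (m : ZMod p))).2 = s := by
    intro m
    induction m with
    | zero => simp [hs]
    | succ m ih =>
      push_cast
      refine ⟨(hlayer _).symm.trans ih.1, ?_, (hstep _).trans ih.2.2⟩
      linear_combination ih.2.2 + ih.2.1
  have hall : ∀ j, (φ (0, j)).1 = (φ (0, 0)).1 ∧ (φ (0, j)).2 = s * j + (φ (0, 0)).2 := by
    intro j
    have := hnat j.val
    rw [ZMod.natCast_zmod_val] at this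
    exact ⟨this.1, this.2.1⟩
  have hs' := adj_of_fst_eq h1 hk0 (hadj 0) (hlayer 0)
  rw [← hs] at hs'
  have hinner : (φ (1, 0)).1 = (φ (1, (k : ZMod p))).1 := by
    have e0 := hspoke 0
    have ek := hspoke k
    rw [(hall k).1] at ek
    generalize (φ (0, 0)).1 = x at *
    generalize (φ (1, 0)).1 = y at *
    generalize (φ (1, (k : ZMod p))).1 = z at *
    clear * - e0 ek
    revert x y z
    decide
  have hk_step := adj_of_fst_eq h1 hk0
    (φ.map_adj_iff.2 ((adj_inner hk0 0 (1, (k : ZMod p))).2 (by simp))) hinner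
  rw [hpos, hpos, (hall k).2, (hall 0).2] at hk_step
  have h0 := hspoke 0
  obtain ⟨hl, hs'⟩ | ⟨hl, hs'⟩ := hs'
  · refine ⟨s, (φ (0, 0)).2, hs', fun i j => ?_⟩
    obtain rfl | rfl := zmod_two_cases i
    · exact Prod.ext ((hall j).1.trans hl) (hall j).2
    · refine Prod.ext ?_ ((hpos j).trans (hall j).2)
      have := hspoke j
      rw [(hall j).1, hl] at this
      exact (zmod_two_cases _).resolve_left this.symm
  -- If the rims were exchanged, then `s = ±k`, while the inner edge from `0` to `k` maps to an
  -- outer edge, so `s * k = ±1`.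
  · exfalso
    rw [hl] at h0
    obtain ⟨-, h⟩ | ⟨h, -⟩ := hk_step
    · obtain rfl | rfl := hs' <;> obtain h | h := h
      · exact hk (by linear_combination h)
      · exact hk' (by linear_combination h)
      · exact hk' (by linear_combination -h)
      · exact hk (by linear_combination -h)
    · exact h0 h.symm

end GenPetersen

/-! ### The dihedral group and the signs -/

namespace GenPetersen

theorem rotation_pow_apply (n k m : ℕ) (i : ZMod 2) (j : ZMod n) :
    (rotation n k ^ m) (i, j) = (i, j + m) := by
  induction m with
  | zero => simp
  | succ m ih =>
    rw [pow_succ']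
    change rotation n k ((rotation n k ^ m) (i, j)) = _
    rw [ih]
    change (i, j + m + 1) = _
    rw [Nat.cast_succ, add_assoc]

/-- The action of the dihedral group on `GP(n, k)`. -/
def dihedralAut (n k : ℕ) [NeZero n] : DihedralGroup n → (graph n k ≃g graph n k)
  | .r a => rotation n k ^ a.val
  | .sr a => reflection n k * rotation n k ^ a.val

theorem dihedralAut_r_apply {n k : ℕ} [NeZero n] (a : ZMod n) (i : ZMod 2) (j : ZMod n) :
    dihedralAut n k (.r a) (i, j) = (i, j + a) := by
  rw [dihedralAut, rotation_pow_apply, ZMod.natCast_zmod_val]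

theorem dihedralAut_sr_apply {n k : ℕ} [NeZero n] (a : ZMod n) (i : ZMod 2) (j : ZMod n) :
    dihedralAut n k (.sr a) (i, j) = (i, -(j + a)) := by
  change reflection n k ((rotation n k ^ a.val) (i, j)) = _
  rw [rotation_pow_apply, ZMod.natCast_zmod_val]
  rfl

theorem dihedralAut_mul {n k : ℕ} [NeZero n] (x y : DihedralGroup n) :
    dihedralAut n k (x * y) = dihedralAut n k x * dihedralAut n k y := by
  refine RelIso.ext fun v => ?_
  obtain ⟨i, j⟩ := v
  change _ = dihedralAut n k x (dihedralAut n k y (i, j))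
  obtain a | a := x <;> obtain b | b := y <;>
    simp only [DihedralGroup.r_mul_r, DihedralGroup.r_mul_sr, DihedralGroup.sr_mul_r,
      DihedralGroup.sr_mul_sr, dihedralAut_r_apply, dihedralAut_sr_apply, Prod.mk.injEq,
      true_and] <;> ring

theorem dihedralAut_injective {n k : ℕ} [NeZero n] (h2 : (2 : ZMod n) ≠ 0) :
    Function.Injective (dihedralAut n k) := by
  intro x y h
  have h0 := DFunLike.congr_fun h ((0 : ZMod 2), (0 : ZMod n))
  have h1 := DFunLike.congr_fun h ((0 : ZMod 2), (1 : ZMod n))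
  obtain a | a := x <;> obtain b | b := y <;>
    simp only [dihedralAut_r_apply, dihedralAut_sr_apply, Prod.mk.injEq, true_and] at h0 h1
  · simpa using h0
  · exact (h2 (by linear_combination h1 - h0)).elim
  · exact (h2 (by linear_combination h0 - h1)).elim
  · simpa using h0

theorem dihedralAut_surjective {n k : ℕ} [NeZero n]
    (haff : ∀ φ : graph n k ≃g graph n k, ∃ s a : ZMod n, (s = 1 ∨ s = -1) ∧
      ∀ i j, φ (i, j) = (i, s * j + a)) : Function.Surjective (dihedralAut n k) := by
  intro φ
  obtain ⟨s, a, rfl | rfl, h⟩ := haff φ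
  · refine ⟨.r a, RelIso.ext fun v => ?_⟩
    obtain ⟨i, j⟩ := v
    rw [h, dihedralAut_r_apply, one_mul]
  -- `sr` rotates before reflecting, so the translation changes sign.
  · refine ⟨.sr (-a), RelIso.ext fun v => ?_⟩
    obtain ⟨i, j⟩ := v
    rw [h, dihedralAut_sr_apply]
    congr 1
    ring

theorem exists_dihedral_mulEquiv {n k : ℕ} [NeZero n] (h2 : (2 : ZMod n) ≠ 0)
    (haff : ∀ φ : graph n k ≃g graph n k, ∃ s a : ZMod n, (s = 1 ∨ s = -1) ∧
      ∀ i j, φ (i, j) = (i, s * j + a)) :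
    ∃ e : DihedralGroup n ≃* (graph n k ≃g graph n k),
      e (DihedralGroup.r 1) = rotation n k ∧ e (DihedralGroup.sr 0) = reflection n k := by
  refine ⟨MulEquiv.ofBijective (MulHom.mk (dihedralAut n k) dihedralAut_mul)
    ⟨dihedralAut_injective h2, dihedralAut_surjective haff⟩, ?_, ?_⟩
  · refine RelIso.ext fun v => ?_
    exact dihedralAut_r_apply 1 v.1 v.2
  · refine RelIso.ext fun v => ?_
    refine (dihedralAut_sr_apply 0 v.1 v.2).trans ?_
    rw [add_zero]
    rfl

/-- If an automorphism maps a set of edges with constant sign to itself, then it preserves the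
signs of these edges. -/
theorem sign_mapEdgeSet {V : Type*} {Γ : SimpleGraph V} (Ψ : SignedGraph Γ) (φ : Γ ≃g Γ)
    {F : Set (Sym2 V)} (hF : ∀ e ∈ F, e.map φ ∈ F) (hs : (Ψ.signs F).ncard = 1)
    (e : Γ.edgeSet) (he : (e : Sym2 V) ∈ F) : Ψ.sign (φ.mapEdgeSet e) = Ψ.sign e := by
  obtain ⟨s, hs⟩ := Set.ncard_eq_one.1 hs
  have h1 : Ψ.sign e ∈ Ψ.signs F := ⟨e, he, rfl⟩
  have h2 : Ψ.sign (φ.mapEdgeSet e) ∈ Ψ.signs F := ⟨_, hF _ he, rfl⟩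
  rw [hs] at h1 h2
  exact h2.trans h1.symm

theorem aut_eq_top {n k : ℕ} (Ψ : SignedGraph (graph n k))
    (haff : ∀ φ : graph n k ≃g graph n k, ∃ s a : ZMod n, (s = 1 ∨ s = -1) ∧
      ∀ i j, φ (i, j) = (i, s * j + a))
    (hO : (Ψ.signs (outerEdges n)).ncard = 1) (hI : (Ψ.signs (innerEdges n k)).ncard = 1)
    (hS : (Ψ.signs (spokes n)).ncard = 1) : Ψ.Aut = ⊤ := by
  refine eq_top_iff.2 fun φ _ e => ?_
  obtain ⟨s, a, hs, h⟩ := haff φ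
  have he : (e : Sym2 _) ∈ outerEdges n ∪ innerEdges n k ∪ spokes n :=
    ((SimpleGraph.edgeSet_fromEdgeSet _).subset e.2).1
  obtain (he | he) | he := he
  · refine sign_mapEdgeSet Ψ φ ?_ hO e he
    rintro _ ⟨j, rfl⟩
    rw [Sym2.map_mk, h, h]
    obtain rfl | rfl := hs
    · exact ⟨j + a, by ring_nf⟩
    · exact ⟨-j + a - 1, by rw [Sym2.eq_swap]; ring_nf⟩
  · refine sign_mapEdgeSet Ψ φ ?_ hI e he
    rintro _ ⟨j, rfl⟩
    rw [Sym2.map_mk, h, h]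
    obtain rfl | rfl := hs
    · exact ⟨j + a, by ring_nf⟩
    · exact ⟨-j + a - k, by rw [Sym2.eq_swap]; ring_nf⟩
  · refine sign_mapEdgeSet Ψ φ ?_ hS e he
    rintro _ ⟨j, rfl⟩
    rw [Sym2.map_mk, h, h]
    exact ⟨_, rfl⟩

theorem ncard_signs_of_rotation_mem {n k : ℕ} [NeZero n] {Ψ : SignedGraph (graph n k)}
    (hrot : rotation n k ∈ Ψ.Aut) (x y : ZMod n → ZMod 2 × ZMod n)
    (hx : ∀ j, rotation n k (x j) = x (j + 1)) (hy : ∀ j, rotation n k (y j) = y (j + 1))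
    (hadj : ∀ j, (graph n k).Adj (x j) (y j)) :
    (Ψ.signs {e | ∃ j, e = s(x j, y j)}).ncard = 1 := by
  have hconst : ∀ m : ℕ, Ψ.sign ⟨s(x m, y m), hadj m⟩ = Ψ.sign ⟨s(x 0, y 0), hadj 0⟩ := by
    intro m
    induction m with
    | zero => simp
    | succ m ih =>
      rw [← ih, ← hrot ⟨s(x m, y m), hadj m⟩]
      congr 1
      ext1
      change s(x _, y _) = s(rotation n k (x m), rotation n k (y m))
      rw [hx, hy, Nat.cast_succ]
  refine Set.ncard_eq_one.2 ⟨Ψ.sign ⟨s(x 0, y 0), hadj 0⟩, Set.ext fun t => ⟨?_, ?_⟩⟩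
  · rintro ⟨⟨e, he⟩, ⟨j, rfl⟩, rfl⟩
    have := hconst j.val
    simpa only [ZMod.natCast_zmod_val, Set.mem_singleton_iff] using this
  · rintro rfl
    exact ⟨_, ⟨0, rfl⟩, rfl⟩

theorem rotation_mem_of_two_lt_card {p k : ℕ} [Fact p.Prime] (hp : p ≠ 2)
    (e : DihedralGroup p ≃* (graph p k ≃g graph p k)) (he : e (.r 1) = rotation p k)
    (H : Subgroup (graph p k ≃g graph p k)) (hH : 2 < Nat.card H) : rotation p k ∈ H := by
  have hcard : Nat.card (graph p k ≃g graph p k) = 2 * p := by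
    rw [← Nat.card_congr e.toEquiv, DihedralGroup.nat_card]
  have hdvd : Nat.card H ∣ 2 * p := hcard ▸ H.card_subgroup_dvd_card
  -- If the order of `H` were prime to `p`, it would divide 2.
  have hpH : p ∣ Nat.card H := by
    by_contra h
    have hco : (Nat.card H).Coprime p := ((Fact.out : p.Prime).coprime_iff_not_dvd.2 h).symm
    exact absurd (Nat.le_of_dvd two_pos (hco.dvd_of_dvd_mul_right hdvd)) (by omega)
  have : Finite H := Nat.finite_of_card_ne_zero (by omega)
  obtain ⟨g, hg⟩ := exists_prime_orderOf_dvd_card' p hpH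
  rw [← Subgroup.orderOf_coe, ← MulEquiv.orderOf_eq e.symm] at hg
  obtain ⟨x, hx⟩ : ∃ x, x = e.symm (g : graph p k ≃g graph p k) := ⟨_, rfl⟩
  rw [← hx] at hg
  have hgx : (g : graph p k ≃g graph p k) = e x := by rw [hx, MulEquiv.apply_symm_apply]
  obtain a | a := x
  -- An element of order `p ≠ 2` is a nontrivial rotation `r a`; its power with exponent `a⁻¹` is `r
  -- 1`.
  · have ha : a ≠ 0 := by
      rintro rfl
      rw [DihedralGroup.r_zero, orderOf_one] at hg
      exact (Fact.out : p.Prime).one_lt.ne hg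
    have hpow : rotation p k = (g : graph p k ≃g graph p k) ^ (a⁻¹).val := by
      rw [hgx, ← map_pow, DihedralGroup.r_pow, ZMod.natCast_zmod_val, mul_inv_cancel₀ ha, he]
    rw [hpow]
    exact H.pow_mem g.2 _
  · rw [DihedralGroup.orderOf_sr] at hg
    exact (hp hg.symm).elim

end GenPetersen

theorem mainTheorem4 (p k : ℕ) (hp : p.Prime) (hp7 : 7 ≤ p)
    (hk1 : 1 ≤ k) (hk2 : k ≤ (p - 1) / 2)
    (hk_one : ¬ (k : ℤ) ^ 2 ≡ 1 [ZMOD (p : ℤ)])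
    (hk_neg_one : ¬ (k : ℤ) ^ 2 ≡ -1 [ZMOD (p : ℤ)])
    (Ψ : SignedGraph (GenPetersen.graph p k)) :
    (∃ e : DihedralGroup p ≃* (GenPetersen.graph p k ≃g GenPetersen.graph p k),
      e (DihedralGroup.r 1) = GenPetersen.rotation p k ∧
      e (DihedralGroup.sr 0) = GenPetersen.reflection p k) ∧
    Nat.card (GenPetersen.graph p k ≃g GenPetersen.graph p k) = 2 * p ∧
    (((Ψ.signs (GenPetersen.outerEdges p)).ncard = 1 ∧
        (Ψ.signs (GenPetersen.innerEdges p k)).ncard = 1 ∧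
        (Ψ.signs (GenPetersen.spokes p)).ncard = 1) →
      Ψ.Aut = ⊤) ∧
    (¬ ((Ψ.signs (GenPetersen.outerEdges p)).ncard = 1 ∧
        (Ψ.signs (GenPetersen.innerEdges p k)).ncard = 1 ∧
        (Ψ.signs (GenPetersen.spokes p)).ncard = 1) →
      Nat.card Ψ.Aut ≤ 2) := by
  have : Fact p.Prime := ⟨hp⟩
  -- The bound `7 ≤ p` makes 2, 3 and 5 invertible.
  have hsmall : ∀ m : ℕ, 0 < m → m < p → (m : ZMod p) ≠ 0 := fun m h0 hm h =>
    absurd (Nat.le_of_dvd h0 ((ZMod.natCast_eq_zero_iff m p).1 h)) (by omega)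
  have h2 : (2 : ZMod p) ≠ 0 := mod_cast hsmall 2 (by omega) (by omega)
  have h3 : (3 : ZMod p) ≠ 0 := mod_cast hsmall 3 (by omega) (by omega)
  have h5 : (5 : ZMod p) ≠ 0 := mod_cast hsmall 5 (by omega) (by omega)
  have hk0 : (k : ZMod p) ≠ 0 := hsmall k hk1 (by omega)
  have hk : (k : ZMod p) ^ 2 ≠ 1 := fun h =>
    hk_one ((ZMod.intCast_eq_intCast_iff _ _ _).1 (by simpa using h))
  have hk' : (k : ZMod p) ^ 2 ≠ -1 := fun h =>
    hk_neg_one ((ZMod.intCast_eq_intCast_iff _ _ _).1 (by simpa using h))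
  have haff := GenPetersen.exists_affine h2 h3 h5 hk0 hk hk'
  obtain ⟨e, her, hes⟩ := GenPetersen.exists_dihedral_mulEquiv h2 haff
  refine ⟨⟨e, her, hes⟩, ?_, fun h => GenPetersen.aut_eq_top Ψ haff h.1 h.2.1 h.2.2, fun h => ?_⟩
  · rw [← Nat.card_congr e.toEquiv, DihedralGroup.nat_card]
  · by_contra! hcard
    have hrot := GenPetersen.rotation_mem_of_two_lt_card (by omega) e her Ψ.Aut hcard
    refine h ⟨?_, ?_, ?_⟩
    · exact GenPetersen.ncard_signs_of_rotation_mem hrot (fun j => (0, j)) (fun j => (0, j + 1))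
        (fun _ => rfl) (fun _ => rfl)
        (fun _ => (GenPetersen.adj_outer one_ne_zero _ _).2 (Or.inl rfl))
    · exact GenPetersen.ncard_signs_of_rotation_mem hrot (fun j => (1, j)) (fun j => (1, j + k))
        (fun _ => rfl) (fun j => Prod.ext rfl (add_right_comm j (k : ZMod p) 1))
        (fun _ => (GenPetersen.adj_inner hk0 _ _).2 (Or.inl rfl))
    · exact GenPetersen.ncard_signs_of_rotation_mem hrot (fun j => (0, j)) (fun j => (1, j))
        (fun _ => rfl) (fun _ => rfl)
        (fun _ => (GenPetersen.adj_outer one_ne_zero _ _).2 (Or.inr (Or.inr rfl)))
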